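/- **Setting.** Let $\langle \varepsilon^k_j : j\le k<\omega\rangle$ be real numbers such that for all $k$: $0<\varepsilon^k_0<\varepsilon^k_1<\dots<\varepsilon^k_k<2^{-k}$, and for all $j<k$: $(\varepsilon^k_{j+1})^3>\varepsilon^k_j$, $\ \varepsilon^k_{j+1}/2^{k^2}>\varepsilon^k_j$ and $\varepsilon^k_j/\varepsilon^k_{j+1}<\varepsilon^k_k$. Let $g\in\omega^\omega$ be strictly increasing, and let $\langle n_k:k\in\omega\rangle$ be a strictly increasing sequence of natural numbers with $n_0=0$ and $$n_{k+1}\ \ge\ g\left(\left\lceil (k+1)\,2^{n_k}\,\frac{2^{n_k2^{n_k}}}{\varepsilon^k_0}\right\rceil\right)\qquad\text{for all }k .$$ Let $F_k$ be the finite set of all functions from $2^{[n_k,n_{k+1})}$ to $\{0,1\}$; for $A\subseteq F_k$ let $\|A\|$ be the largest $\ell\le k$ with $|A|/|F_k|\ge\varepsilon^k_\ell$ (and $\|A\|=0$ if there is none). Let $T^{max}=\bigcup_k\prod_{j<k}F_j$. The forcing notion $\mathbb P_g$ consists of all perfect subtrees $T\subseteq T^{max}$ (nonempty, closed under initial segments,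 every node having an extension in $T$ with at least two immediate successors in $T$) such that $$\lim_{k\to\infty}\min\{\|\mathrm{succ}_T(s)\| : s\in T\cap\textstyle\prod_{j<k}F_j\}=\infty ,$$ where $\mathrm{succ}_T(s)=\{x\in F_k: s^\frown x\in T\}$ for $s \in T$ of length $k$; a condition $T$ is stronger than $S$ if $T\subseteq S$. **Theorem.** Let $X\subseteq 2^\omega$ be a set in the ground model $\mathbf V$ that does not have measure zero in $\mathbf V$ with respect to the standard product measure on $2^\omega$. Then $\mathbf V^{\mathbb P_g}\models$ "$X$ does not have measure zero"; that is, every condition of $\mathbb P_g$ forces that $\check X$ is not a measure zero subset of $2^\omega$. Here "$Y\subseteq 2^\omega$ has measure zero" means, in the extension, that for every $k\in\omega$ there is $A\subseteq 2^{<\omega}$ with $\sum_{s\in A}2^{-|s|}\le 2^{-k}$ such that every $y\in Y$ has an initial segment in $A$. -/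

import Mathlib

/-! ### Forcing: names, the forcing relation, and the canonical names of ground-model sets

The ground model `V` is the universe of sets `PSet.{0}` over `Type`.  In a forcing notion `P`
(a preorder) `p ≤ q` means that `q` is the stronger condition. -/

/-- `P`-names: a name is a set of pairs (name, condition). -/
inductive PName (P : Type) : Type 1
  | mk (ι : Type) (val : ι → PName P) (cond : ι → P) : PName P

/-- Statements of the forcing language of `P`, each given by the set of conditions forcing it. -/
abbrev ForcingStatement (P : Type) : Type := P → Prop

namespace ForcingStatement

variable {P : Type} [Preorder P]

/-- `p ⊩ a = b`: whenever `(c, r) ∈ a`, densely many conditions above `p` and `r` are above some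
`r'` with `(d, r') ∈ b` and force `c = d`; and symmetrically. -/
def eq : PName P → PName P → ForcingStatement P
  | ⟨_, a, r⟩, ⟨_, b, r'⟩ => fun p =>
    (∀ i, ∀ q, p ≤ q → r i ≤ q → ∃ q', q ≤ q' ∧ ∃ j, r' j ≤ q' ∧ eq (a i) (b j) q') ∧
    (∀ j, ∀ q, p ≤ q → r' j ≤ q → ∃ q', q ≤ q' ∧ ∃ i, r i ≤ q' ∧ eq (a i) (b j) q')

/-- `p ⊩ a ∈ b`: the conditions that are above some `r` with `(c, r) ∈ b` and force `a = c`
are dense above `p`. -/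
def mem (a : PName P) : PName P → ForcingStatement P
  | ⟨_, b, r⟩ => fun p => ∀ q, p ≤ q → ∃ q', q ≤ q' ∧ ∃ j, r j ≤ q' ∧ eq a (b j) q'

/-- Negation. -/
def not (φ : ForcingStatement P) : ForcingStatement P := fun p => ∀ q, p ≤ q → ¬ φ q

/-- Conjunction. -/
def and (φ ψ : ForcingStatement P) : ForcingStatement P := fun p => φ p ∧ ψ p

/-- Implication. -/
def imp (φ ψ : ForcingStatement P) : ForcingStatement P := fun p => ∀ q, p ≤ q → φ q → ψ q

/-- Universal quantification over all names. -/
def all (φ : PName P → ForcingStatement P) : ForcingStatement P := fun p => ∀ a, φ a p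

/-- Existential quantification over all names. -/
def ex (φ : PName P → ForcingStatement P) : ForcingStatement P :=
  fun p => ∀ q, p ≤ q → ∃ q', q ≤ q' ∧ ∃ a, φ a q'

/-- `∀ x ∈ b, φ x`. -/
def allMem (b : PName P) (φ : PName P → ForcingStatement P) : ForcingStatement P :=
  all fun x => imp (mem x b) (φ x)

/-- `∃ x ∈ b, φ x`. -/
def exMem (b : PName P) (φ : PName P → ForcingStatement P) : ForcingStatement P :=
  ex fun x => and (mem x b) (φ x)

/-- `a ⊆ b`. -/
def subset (a b : PName P) : ForcingStatement P := allMem a fun x => mem x b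

/-- `V^P ⊨ φ`: every condition forces `φ`. -/
def HoldsInExtension (φ : ForcingStatement P) : Prop := ∀ p, φ p

end ForcingStatement

/-- The canonical name `x̌` of a ground-model set `x`, that is `{(y̌, p) : y ∈ x, p ∈ P}`. -/
def checkName (P : Type) : PSet.{0} → PName P
  | ⟨ι, x⟩ => ⟨ι × P, fun i => checkName P (x i.1), fun i => i.2⟩

/-! ### Reals, binary strings, and null sets as objects of set theory -/

/-- The Kuratowski pair. -/
def pairSet (a b : PSet.{0}) : PSet.{0} := {{a}, {a, b}}

/-- The bits `0 = ∅` and `1 = {∅}`. -/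
def bitSet (b : Bool) : PSet.{0} := PSet.ofNat (if b then 1 else 0)

/-- A point `x` of `2^ω`, as the set of pairs `(i, x i)`. -/
def realSet (x : ℕ → Bool) : PSet.{0} :=
  ⟨ℕ, fun i => pairSet (PSet.ofNat i) (bitSet (x i))⟩

/-- A finite binary string, as the set of pairs (position, bit). -/
def stringSet (s : List Bool) : PSet.{0} :=
  ⟨Fin s.length, fun i => pairSet (PSet.ofNat i) (bitSet (s.get i))⟩

/-- A subset of `2^ω` as a set. -/
def realsSet (X : Set (ℕ → Bool)) : PSet.{0} := ⟨X, fun x => realSet x⟩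

/-- The set `2^{<ω}` of all finite binary strings. -/
def allStrings : PSet.{0} := ⟨List Bool, stringSet⟩

/-- A finite set of finite binary strings. -/
def familySet (F : Finset (List Bool)) : PSet.{0} := ⟨F, fun s => stringSet s⟩

/-- The set of all finite `F ⊆ 2^{<ω}` with `∑_{s ∈ F} 2^{-|s|} > 2^{-k}`. -/
def heavyFamilies (k : ℕ) : PSet.{0} :=
  ⟨{F : Finset (List Bool) // (2⁻¹ : ℝ) ^ k < ∑ s ∈ F, (2⁻¹ : ℝ) ^ s.length},
    fun F => familySet F.1⟩

/-- The set `{heavyFamilies k : k ∈ ω}`.  The definition of `heavyFamilies k` is absolute (it only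
speaks of hereditarily finite sets), so the canonical names of this set and of its elements denote
the sets that have the same definitions in the extension. -/
def heavyFamiliesSet : PSet.{0} := ⟨ℕ, heavyFamilies⟩

/-- The statement "`Y` is a measure zero subset of `2^ω`" of the forcing language: for every `k`
there is `A ⊆ 2^{<ω}` with `∑_{s ∈ A} 2^{-|s|} ≤ 2^{-k}` (no finite subset of `A` has a larger
sum) such that the basic open sets `[s]`, `s ∈ A`, cover `Y`. -/
def isNullStatement {P : Type} [Preorder P] (Y : PName P) : ForcingStatement P :=
  .allMem (checkName P heavyFamiliesSet) fun D =>
    .ex fun A =>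
      .and (.subset A (checkName P allStrings))
        (.and (.allMem D fun F => .not (.subset F A))
          (.allMem Y fun y => .exMem A fun s => .subset s y))

/-- The standard product measure on `2^ω`. -/
noncomputable def cantorMeasure : MeasureTheory.Measure (ℕ → Bool) :=
  MeasureTheory.Measure.infinitePi fun _ : ℕ => (PMF.uniformOfFintype Bool).toMeasure

/-! ### The forcing notion `P_g` -/

/-- The requirements on the numbers `ε k j` (that is `ε^k_j`), `j ≤ k`. -/
structure IsNormScale (ε : ℕ → ℕ → ℝ) : Prop where
  pos : ∀ k, 0 < ε k 0
  lt_succ : ∀ k, ∀ j < k, ε k j < ε k (j + 1)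
  lt_two_pow : ∀ k, ε k k < (2⁻¹ : ℝ) ^ k
  lt_cube : ∀ k, ∀ j < k, ε k j < ε k (j + 1) ^ 3
  lt_div : ∀ k, ∀ j < k, ε k j < ε k (j + 1) / 2 ^ k ^ 2
  div_lt : ∀ k, ∀ j < k, ε k j / ε k (j + 1) < ε k k

/-- The requirements on the sequence `n_k`. -/
structure IsPartitionFor (g : ℕ → ℕ) (ε : ℕ → ℕ → ℝ) (n : ℕ → ℕ) : Prop where
  strictMono : StrictMono n
  zero : n 0 = 0
  growth : ∀ k : ℕ, g ⌈((k : ℝ) + 1) * 2 ^ n k * (2 ^ (n k * 2 ^ n k) / ε k 0)⌉₊ ≤ n (k + 1)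

/-- The finite set `F_k` of all functions `2^{[n_k, n_{k+1})} → {0, 1}`. -/
abbrev Block (n : ℕ → ℕ) (k : ℕ) : Type := (Set.Ico (n k) (n (k + 1)) → Bool) → Bool

/-- The nodes of length `k` of `T^max`, that is `∏_{j < k} F_j`. -/
abbrev Node (n : ℕ → ℕ) (k : ℕ) : Type := ∀ j : Fin k, Block n j

/-- The node `s⌢x`. -/
def Node.append {n : ℕ → ℕ} {k : ℕ} (s : Node n k) (x : Block n k) : Node n (k + 1) :=
  Fin.snoc (α := fun j : Fin (k + 1) => Block n j) s x

/-- The norm of `A ⊆ F_k`: the largest `ℓ ≤ k` with `|A| / |F_k| ≥ ε^k_ℓ`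
(`0` if there is no such `ℓ`). -/
noncomputable def blockNorm (ε : ℕ → ℕ → ℝ) {n : ℕ → ℕ} {k : ℕ} (A : Set (Block n k)) : ℕ :=
  sSup {l : ℕ | l ≤ k ∧ ε k l ≤ (A.ncard : ℝ) / (Nat.card (Block n k) : ℝ)}

/-- The set of immediate successors of `s` in the tree with levels `T k`. -/
def succSet {n : ℕ → ℕ} (T : ∀ k, Set (Node n k)) {k : ℕ} (s : Node n k) : Set (Block n k) :=
  {x | s.append x ∈ T (k + 1)}

/-- The conditions of `P_g`: perfect subtrees of `T^max`, given by their levels, in which the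
minimal norm of the successor sets on level `k` tends to infinity with `k`. -/
@[ext]
structure TreeForcing (ε : ℕ → ℕ → ℝ) (n : ℕ → ℕ) : Type where
  level : ∀ k, Set (Node n k)
  nonempty : (level 0).Nonempty
  init_mem : ∀ k, ∀ s : Node n (k + 1), s ∈ level (k + 1) →
    (fun j : Fin k => s j.castSucc) ∈ level k
  perfect : ∀ k, ∀ s ∈ level k, ∃ m, ∃ h : k ≤ m, ∃ t ∈ level m,
    (∀ j : Fin k, t (j.castLE h) = s j) ∧ (succSet level t).Nontrivial
  tendsto_norm : Filter.Tendsto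
    (fun k => sInf {a : ℕ | ∃ s ∈ level k, blockNorm ε (succSet level s) = a})
    Filter.atTop Filter.atTop

/-- `S ≤ T` (`T` is stronger) means `T ⊆ S`. -/
instance (ε : ℕ → ℕ → ℝ) (n : ℕ → ℕ) : PartialOrder (TreeForcing ε n) where
  le S T := ∀ k, T.level k ⊆ S.level k
  le_refl _ _ := subset_rfl
  le_trans _ _ _ h h' k := (h' k).trans (h k)
  le_antisymm _ _ h h' := TreeForcing.ext (funext fun k => (h' k).antisymm (h k))

/-!
Fix a condition forcing that `X` is covered, for each `k`, by basic open sets of total weight at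
most `2^{-k}`. After unwinding the forcing relation (`exists_cover_of_isNullStatement`) there is,
for a `k` with `2 * 2^{-(k+1)}` below the outer measure of `X`, a condition `p` and a monotone map
`F` from conditions to sets of strings, `F r` being what `r` forces into the cover. Every `F r` has
weight at most `2^{-(k+1)}`, and every point of `X` gets covered by `F r'` for densely many `r'`.
The contradiction comes from a point `x ∈ X` and a condition above which `x` is never covered.

Consecutive thresholds `ε^k_j < ε^k_{j+1}` have a quotient below `2^{-k}`, so passing to a
proportion `2^{-k}` of the successors on level `k` costs at most one unit of norm
(`le_blockNorm_of_proportion`), and a tree all of whose nodes are thinned out in this way is still a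
condition (`TreeForcing.exists_thinning`). This is used twice.

* Pure decision: every dense open property is decided at some finite level of a stronger condition
  that agrees with the given one up to a given level and loses little norm
  (`TreeForcing.exists_decidedAt`). If a node had no extension of this kind, then more than half of
  its successors would not have one either, and the nodes without one would contain a condition; but
  a stronger condition with the property has large norms beyond some level. By fusion
  (`TreeForcing.exists_forall_decidedAt`) some `q` decides every string at a finite level.
* Averaging: call a point lost at a node of level `k` if it is covered there, or, inductively, if
  fewer than a proportion `2^{-k}` of the successors keep it. By Markov's inequality
  the measure of the lost points grows by a factor of at most `1 / (1 - 2^{-k})` per level, so above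
  level `2` it at most doubles (`TreeForcing.cantorMeasure_iUnion_lostSet_le`). Hence some `x ∈ X`
  is not lost at a node of level `2`, and the nodes where `x` is not lost contain a condition
  (`TreeForcing.exists_forall_notMem_lostSet`). Since `q` decides every string, no condition above
  it can force `x` into the cover.

Of the growth of `n` only `ε^k_0 * |F_k| ≥ 1` matters: it makes sets of norm at least `1` have two
elements, so that large norms entail perfectness (`TreeForcing.exists_of_levels`).
-/

/-! ### Equality and membership in the forcing language -/

namespace ForcingStatement

variable {P : Type} [Preorder P]

theorem eq_mono {a b : PName P} {p q : P} (hpq : p ≤ q) (h : eq a b p) : eq a b q := by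
  cases a; cases b
  simp only [eq] at h ⊢
  exact ⟨fun i r hr => h.1 i r (hpq.trans hr), fun j r hr => h.2 j r (hpq.trans hr)⟩

theorem mem_mono {a b : PName P} {p q : P} (hpq : p ≤ q) (h : mem a b p) : mem a b q := by
  cases b
  exact fun r hr => h r (hpq.trans hr)

theorem eq_refl (a : PName P) (p : P) : eq a a p := by
  induction a generalizing p with
  | mk ι a r ih =>
    simp only [eq]
    exact ⟨fun i q _ hi => ⟨q, le_rfl, i, hi, ih i q⟩, fun i q _ hi => ⟨q, le_rfl, i, hi, ih i q⟩⟩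

theorem eq_symm {a b : PName P} {p : P} (h : eq a b p) : eq b a p := by
  induction a generalizing b p with
  | mk ι a r ih =>
    cases b
    simp only [eq] at h ⊢
    constructor
    · intro j q hq hj
      obtain ⟨q', hq', i, hi, e⟩ := h.2 j q hq hj
      exact ⟨q', hq', i, hi, ih i e⟩
    · intro i q hq hi
      obtain ⟨q', hq', j, hj, e⟩ := h.1 i q hq hi
      exact ⟨q', hq', j, hj, ih i e⟩

theorem eq_trans {a b c : PName P} {p : P} (h : eq a b p) (h' : eq b c p) : eq a c p := by
  induction a generalizing b c p with
  | mk ι a r ih =>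
    cases b
    cases c
    simp only [eq] at h h' ⊢
    constructor
    · intro i q hq hi
      obtain ⟨q', hq', j, hj, e⟩ := h.1 i q hq hi
      obtain ⟨q'', hq'', l, hl, e'⟩ := h'.1 j q' (hq.trans hq') hj
      exact ⟨q'', hq'.trans hq'', l, hl, ih i (eq_mono hq'' e) e'⟩
    · intro l q hq hl
      obtain ⟨q', hq', j, hj, e⟩ := h'.2 l q hq hl
      obtain ⟨q'', hq'', i, hi, e'⟩ := h.2 j q' (hq.trans hq') hj
      exact ⟨q'', hq'.trans hq'', i, hi, ih i e' (eq_mono hq'' e)⟩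

theorem mem_congr_left {a b c : PName P} {p : P} (h : eq a b p) (h' : mem b c p) : mem a c p := by
  cases c
  intro q hq
  obtain ⟨q', hq', j, hj, e⟩ := h' q hq
  exact ⟨q', hq', j, hj, eq_trans (eq_mono (hq.trans hq') h) e⟩

theorem mem_congr_right {a b c : PName P} {p : P} (h : eq b c p) (h' : mem a b p) :
    mem a c p := by
  cases b
  cases c
  intro q hq
  obtain ⟨q₁, hq₁, i, hi, e⟩ := h' q hq
  simp only [eq] at h
  obtain ⟨q₂, hq₂, j, hj, e'⟩ := h.1 i q₁ (hq.trans hq₁) hi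
  exact ⟨q₂, hq₁.trans hq₂, j, hj, eq_trans (eq_mono hq₂ e) e'⟩

theorem mem_of_dense {a b : PName P} {p : P} (h : ∀ q, p ≤ q → ∃ q', q ≤ q' ∧ mem a b q') :
    mem a b p := by
  cases b
  intro q hq
  obtain ⟨q', hq', h'⟩ := h q hq
  obtain ⟨q'', hq'', h''⟩ := h' q' le_rfl
  exact ⟨q'', hq'.trans hq'', h''⟩

theorem mem_checkName {ι : Type} (x : ι → PSet.{0}) (i : ι) (p : P) :
    mem (checkName P (x i)) (checkName P ⟨ι, x⟩) p := by
  simp only [checkName, mem]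
  exact fun q _ => ⟨q, le_rfl, (i, q), le_rfl, eq_refl _ _⟩

theorem exists_eq_of_mem_checkName {ι : Type} {x : ι → PSet.{0}} {a : PName P} {p : P}
    (h : mem a (checkName P ⟨ι, x⟩) p) : ∃ q, p ≤ q ∧ ∃ i, eq a (checkName P (x i)) q := by
  simp only [checkName, mem] at h
  obtain ⟨q, hq, i, -, e⟩ := h p le_rfl
  exact ⟨q, hq, i.1, e⟩

/-- Equality of ground-model sets is absolute. -/
theorem equiv_of_eq_checkName {a b : PSet.{0}} {p : P}
    (h : eq (checkName P a) (checkName P b) p) : PSet.Equiv a b := by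
  induction a generalizing b p with
  | mk ι a ih =>
    cases b
    simp only [checkName, eq] at h
    refine ⟨fun i => ?_, fun j => ?_⟩
    · obtain ⟨q', -, j, -, e⟩ := h.1 (i, p) p le_rfl le_rfl
      exact ⟨j.1, ih i e⟩
    · obtain ⟨q', -, i, -, e⟩ := h.2 (j, p) p le_rfl le_rfl
      exact ⟨i.1, ih i.1 e⟩

end ForcingStatement

/-! ### Strings and reals as sets -/

theorem pairSet_inj {a b c d : PSet.{0}} (h : PSet.Equiv (pairSet a b) (pairSet c d)) :
    PSet.Equiv a c ∧ PSet.Equiv b d := by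
  have h' : ZFSet.pair (ZFSet.mk a) (ZFSet.mk b) = ZFSet.pair (ZFSet.mk c) (ZFSet.mk d) :=
    ZFSet.sound h
  obtain ⟨h₁, h₂⟩ := ZFSet.pair_injective h'
  exact ⟨ZFSet.exact h₁, ZFSet.exact h₂⟩

theorem rank_ofNat (k : ℕ) : (PSet.ofNat.{0} k).rank = k := by
  induction k with
  | zero => simp [PSet.ofNat]
  | succ k ih => simp [PSet.ofNat, PSet.rank_insert, ih]

theorem ofNat_inj {k l : ℕ} (h : PSet.Equiv (PSet.ofNat.{0} k) (PSet.ofNat.{0} l)) : k = l := by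
  have := PSet.rank_congr h
  simpa only [rank_ofNat, Nat.cast_inj] using this

theorem bitSet_inj {b c : Bool} (h : PSet.Equiv (bitSet b) (bitSet c)) : b = c := by
  have := ofNat_inj h
  revert this
  cases b <;> cases c <;> simp

/-- `[c]`: the basic open set of all points of `2^ω` with initial segment `c`. -/
def cylinderOf (c : List Bool) : Set (ℕ → Bool) := {x | ∀ i : Fin c.length, x i = c.get i}

open ForcingStatement in
/-- If `c` is forced to be contained in a ground-model real `x`, then `c` is an initial segment
of `x`. -/
theorem mem_cylinderOf_of_subset {P : Type} [Preorder P] {c : List Bool} {x : ℕ → Bool} {p : P}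
    (h : subset (checkName P (stringSet c)) (checkName P (realSet x)) p) : x ∈ cylinderOf c := by
  intro i
  obtain ⟨q, -, j, e⟩ := exists_eq_of_mem_checkName (h _ p le_rfl (mem_checkName _ i p))
  obtain ⟨h₁, h₂⟩ := pairSet_inj (equiv_of_eq_checkName e)
  have h₁ : (i : ℕ) = j := ofNat_inj h₁
  rw [h₁]
  exact (bitSet_inj h₂).symm

open ForcingStatement in
/-- What remains of the forcing relation: if `p` forces `X` to be null, then above `p` there are a
condition `q` and a function `F` sending `r` to the set of strings which `r` forces into the
cover `A`. -/
theorem exists_cover_of_isNullStatement {P : Type} [Preorder P] {X : Set (ℕ → Bool)} {p : P}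
    (h : isNullStatement (checkName P (realsSet X)) p) (k : ℕ) :
    ∃ q, p ≤ q ∧ ∃ F : P → Set (List Bool),
      Monotone F ∧
      (∀ r, q ≤ r → ∀ E : Finset (List Bool), (E : Set (List Bool)) ⊆ F r →
        ∑ c ∈ E, (2⁻¹ : ℝ) ^ c.length ≤ (2⁻¹ : ℝ) ^ k) ∧
      (∀ x ∈ X, ∀ r, q ≤ r → ∃ r', r ≤ r' ∧ ∃ c ∈ F r', x ∈ cylinderOf c) := by
  obtain ⟨q, hpq, A, hA, hw, hc⟩ :=
    h (checkName P (heavyFamilies k)) p le_rfl (mem_checkName _ k p) p le_rfl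
  refine ⟨q, hpq, fun r => {c | mem (checkName P (stringSet c)) A r}, ?_, ?_, ?_⟩
  · exact fun r r' hr c hc => mem_mono hr hc
  · intro r hr E hE
    by_contra! hlt
    have hmem : mem (checkName P (familySet E)) (checkName P (heavyFamilies k)) q :=
      mem_checkName (ι := {F : Finset (List Bool) //
        (2⁻¹ : ℝ) ^ k < ∑ s ∈ F, (2⁻¹ : ℝ) ^ s.length}) (fun F => familySet F.1) ⟨E, hlt⟩ q
    refine hw (checkName P (familySet E)) q le_rfl hmem r hr ?_
    intro x r' hr' hx
    refine mem_of_dense fun r'' hr'' => ?_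
    obtain ⟨s, hs, c, e⟩ := exists_eq_of_mem_checkName (mem_mono hr'' hx)
    exact ⟨s, hs, mem_congr_left e (mem_mono ((hr'.trans hr'').trans hs) (hE c.2))⟩
  · intro x hx r hr
    obtain ⟨r₁, hr₁, s, hs, hsub⟩ :=
      hc (checkName P (realSet x)) q le_rfl
        (mem_checkName (fun x : X => realSet x.1) ⟨x, hx⟩ q) r hr
    obtain ⟨r₂, hr₂, c, e⟩ :=
      exists_eq_of_mem_checkName (hA s r₁ (hr.trans hr₁) hs)
    refine ⟨r₂, hr₁.trans hr₂, c, mem_congr_left (eq_symm e) (mem_mono hr₂ hs), ?_⟩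
    refine mem_cylinderOf_of_subset (p := r₂) fun y r₃ hr₃ hy => ?_
    exact hsub y r₃ (hr₂.trans hr₃) (mem_congr_right (eq_mono hr₃ (eq_symm e)) hy)

/-! ### The norm -/

section Norm

variable {ε : ℕ → ℕ → ℝ} {n : ℕ → ℕ} {k : ℕ}

instance (n : ℕ → ℕ) (k : ℕ) : Finite (Block n k) := by unfold Block; infer_instance

theorem natCard_block (n : ℕ → ℕ) (k : ℕ) :
    Nat.card (Block n k) = 2 ^ 2 ^ (n (k + 1) - n k) := by
  simp [Block]

theorem natCard_block_pos (n : ℕ → ℕ) (k : ℕ) : (0 : ℝ) < Nat.card (Block n k) := by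
  rw [natCard_block]; positivity

theorem IsNormScale.mono (hε : IsNormScale ε) {i j : ℕ} (hij : i ≤ j) (hj : j ≤ k) :
    ε k i ≤ ε k j := by
  induction j, hij using Nat.le_induction with
  | base => exact le_rfl
  | succ j _ ih => exact (ih (by omega)).trans (hε.lt_succ k j (by omega)).le

theorem le_blockNorm {A : Set (Block n k)} {l : ℕ} (hl : l ≤ k)
    (h : ε k l ≤ (A.ncard : ℝ) / (Nat.card (Block n k) : ℝ)) : l ≤ blockNorm ε A :=
  le_csSup ⟨k, fun _ hi => hi.1⟩ ⟨hl, h⟩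

theorem of_le_blockNorm (hε : IsNormScale ε) {A : Set (Block n k)} {l : ℕ} (hl : 1 ≤ l)
    (h : l ≤ blockNorm ε A) :
    l ≤ k ∧ ε k l ≤ (A.ncard : ℝ) / (Nat.card (Block n k) : ℝ) := by
  have hne : {l : ℕ | l ≤ k ∧ ε k l ≤ (A.ncard : ℝ) / (Nat.card (Block n k) : ℝ)}.Nonempty := by
    by_contra! he
    rw [blockNorm, he] at h
    simp at h
    omega
  have := Nat.sSup_mem hne ⟨k, fun _ hi => hi.1⟩
  exact ⟨h.trans this.1, (hε.mono h this.1).trans this.2⟩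

theorem blockNorm_mono (hε : IsNormScale ε) {A B : Set (Block n k)} (hAB : A ⊆ B) :
    blockNorm ε A ≤ blockNorm ε B := by
  rcases Nat.eq_zero_or_pos (blockNorm ε A) with h | h
  · omega
  obtain ⟨h₁, h₂⟩ := of_le_blockNorm hε h le_rfl
  refine le_blockNorm h₁ (h₂.trans ?_)
  gcongr
  exact B.toFinite

/-- A subset of proportion `2^{-k}` loses at most one unit of norm, because consecutive thresholds
have a quotient below `2^{-k}`. -/
theorem le_blockNorm_of_proportion (hε : IsNormScale ε) {A B : Set (Block n k)} {l : ℕ}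
    (hA : l + 1 ≤ blockNorm ε A) (hB : (2⁻¹ : ℝ) ^ k * A.ncard ≤ B.ncard) :
    l ≤ blockNorm ε B := by
  obtain ⟨h₁, h₂⟩ := of_le_blockNorm hε (Nat.le_add_left 1 l) hA
  refine le_blockNorm (by omega) ?_
  have hpos : 0 < ε k (l + 1) := (hε.pos k).trans_le (hε.mono (Nat.zero_le _) h₁)
  have h₃ := (hε.div_lt k l (by omega)).trans (hε.lt_two_pow k)
  rw [div_lt_iff₀ hpos] at h₃
  calc ε k l ≤ (2⁻¹ : ℝ) ^ k * ε k (l + 1) := h₃.le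
    _ ≤ (2⁻¹ : ℝ) ^ k * (A.ncard / Nat.card (Block n k)) := by gcongr
    _ = ((2⁻¹ : ℝ) ^ k * A.ncard) / Nat.card (Block n k) := by ring
    _ ≤ B.ncard / Nat.card (Block n k) := by gcongr

/-- The growth of `n` gives `1 / ε^k_0 ≤ 2 ^ d ≤ |F_k|`, where `d = n_{k+1} - n_k`. -/
theorem one_le_mul_natCard_block {g : ℕ → ℕ} (hg : StrictMono g) (hε : IsNormScale ε)
    (hn : IsPartitionFor g ε n) (k : ℕ) : 1 ≤ ε k 0 * Nat.card (Block n k) := by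
  have hpos := hε.pos k
  set d := n (k + 1) - n k with hd
  have hnk : n (k + 1) = n k + d := by
    have := hn.strictMono (Nat.lt_succ_self k)
    simp only [Nat.succ_eq_add_one] at this
    omega
  have h₁ : ((k : ℝ) + 1) * 2 ^ n k * (2 ^ (n k * 2 ^ n k) / ε k 0) ≤ n (k + 1) :=
    (Nat.le_ceil _).trans (by exact_mod_cast (hg.id_le _).trans (hn.growth k))
  have h₂ : 2 ^ n k * (1 / ε k 0) ≤ ((k : ℝ) + 1) * 2 ^ n k * (2 ^ (n k * 2 ^ n k) / ε k 0) := by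
    gcongr
    · exact le_mul_of_one_le_left (by positivity) (by linarith [(k.cast_nonneg : (0 : ℝ) ≤ k)])
    · exact one_le_pow₀ (by norm_num)
  have h₃ : (n (k + 1) : ℝ) ≤ 2 ^ n k * 2 ^ d := by
    rw [← pow_add, ← hnk]
    exact_mod_cast (Nat.lt_two_pow_self).le
  have h₄ : 1 / ε k 0 ≤ 2 ^ d := le_of_mul_le_mul_left (h₂.trans (h₁.trans h₃)) (by positivity)
  have h₅ : (2 : ℝ) ^ d ≤ 2 ^ 2 ^ d := by
    gcongr
    · norm_num
    · exact (Nat.lt_two_pow_self).le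
  have h₆ := h₄.trans h₅
  rw [div_le_iff₀ hpos] at h₆
  rw [natCard_block, ← hd]
  push_cast
  linarith

theorem nontrivial_of_one_le_blockNorm {g : ℕ → ℕ} (hg : StrictMono g) (hε : IsNormScale ε)
    (hn : IsPartitionFor g ε n) {A : Set (Block n k)} (hA : 1 ≤ blockNorm ε A) :
    A.Nontrivial := by
  obtain ⟨h₁, h₂⟩ := of_le_blockNorm hε le_rfl hA
  have h₃ := one_le_mul_natCard_block hg hε hn k
  have h₄ := hε.lt_succ k 0 (by omega)
  rw [le_div_iff₀ (natCard_block_pos n k)] at h₂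
  have h₅ : (1 : ℝ) < A.ncard :=
    h₃.trans_lt ((mul_lt_mul_of_pos_right h₄ (natCard_block_pos n k)).trans_le h₂)
  exact Set.one_lt_ncard_iff_nontrivial.1 (by exact_mod_cast h₅)

end Norm

/-! ### Nodes -/

section Nodes

variable {n : ℕ → ℕ}

/-- Two nodes are compatible if they agree on their common domain, that is, if one of them is an
initial segment of the other. -/
def Compat {a b : ℕ} (u : Node n a) (t : Node n b) : Prop :=
  ∀ j (hu : j < a) (ht : j < b), u ⟨j, hu⟩ = t ⟨j, ht⟩

/-- The initial segment of length `a` of a node. -/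
def Node.take {a b : ℕ} (h : a ≤ b) (t : Node n b) : Node n a := fun j => t (j.castLE h)

theorem Compat.refl {a : ℕ} (u : Node n a) : Compat u u := fun _ _ _ => rfl

theorem Compat.symm {a b : ℕ} {u : Node n a} {t : Node n b} (h : Compat u t) : Compat t u :=
  fun j hu ht => (h j ht hu).symm

theorem Compat.eq {a : ℕ} {u t : Node n a} (h : Compat u t) : u = t :=
  funext fun j => h j j.2 j.2

/-- Compatibility passes through a node that is at least as long as one of the two others. -/
theorem Compat.trans {a b c : ℕ} {u : Node n a} {t : Node n b} {v : Node n c}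
    (h : Compat u t) (h' : Compat t v) (hb : a ≤ b ∨ c ≤ b) : Compat u v :=
  fun j hu hv => (h j hu (by omega)).trans (h' j (by omega) hv)

theorem compat_take {a b : ℕ} (h : a ≤ b) (t : Node n b) : Compat (t.take h) t :=
  fun _ _ _ => rfl

theorem Node.append_castSucc {k : ℕ} (s : Node n k) (x : Block n k) (j : Fin k) :
    s.append x j.castSucc = s j := by
  simp [Node.append]

theorem Node.append_last {k : ℕ} (s : Node n k) (x : Block n k) :
    s.append x (Fin.last k) = x := by
  simp [Node.append]

theorem compat_append {k : ℕ} (s : Node n k) (x : Block n k) : Compat s (s.append x) :=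
  fun j hu _ => (s.append_castSucc x ⟨j, hu⟩).symm

theorem Node.append_take {k : ℕ} (t : Node n (k + 1)) :
    (t.take k.le_succ).append (t (Fin.last k)) = t := by
  funext j
  refine Fin.lastCases ?_ (fun i => ?_) j
  · exact Node.append_last _ _
  · exact Node.append_castSucc _ _ _

theorem Compat.append_eq {k : ℕ} {s : Node n k} {t : Node n (k + 1)} (h : Compat s t) :
    s.append (t (Fin.last k)) = t := by
  have : s = t.take k.le_succ := (h.trans (compat_take _ t).symm (.inl k.le_succ)).eq
  rw [this]
  exact t.append_take

instance (n : ℕ → ℕ) (k : ℕ) : Finite (Node n k) := by unfold Node; infer_instance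

end Nodes

/-! ### Conditions -/

namespace TreeForcing

variable {ε : ℕ → ℕ → ℝ} {n : ℕ → ℕ}

theorem take_mem (p : TreeForcing ε n) {a b : ℕ} (h : a ≤ b) {t : Node n b}
    (ht : t ∈ p.level b) : t.take h ∈ p.level a := by
  induction b, h using Nat.le_induction with
  | base => exact ht
  | succ b h ih => exact ih (p.init_mem b t ht)

theorem succSet_nonempty (p : TreeForcing ε n) {k : ℕ} {s : Node n k} (hs : s ∈ p.level k) :
    (succSet p.level s).Nonempty := by
  obtain ⟨m, hkm, t, ht, hts, hnt⟩ := p.perfect k s hs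
  obtain ⟨x, hx⟩ := hnt.nonempty
  have h₁ : Compat s ((t.append x).take (Nat.succ_le_succ hkm)) := by
    refine Compat.trans (t := t) (fun j hu _ => (hts ⟨j, hu⟩).symm) ?_ (.inl hkm)
    exact (compat_append t x).trans (compat_take _ _).symm (.inl m.le_succ)
  refine ⟨(t.append x).take (Nat.succ_le_succ hkm) (Fin.last k), ?_⟩
  rw [succSet, Set.mem_ofPred_eq, h₁.append_eq]
  exact p.take_mem _ hx

theorem exists_mem_level (p : TreeForcing ε n) {k m : ℕ} (h : k ≤ m) {s : Node n k}
    (hs : s ∈ p.level k) : ∃ t ∈ p.level m, Compat s t := by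
  induction m, h using Nat.le_induction with
  | base => exact ⟨s, hs, .refl s⟩
  | succ m h ih =>
    obtain ⟨t, ht, hst⟩ := ih
    obtain ⟨x, hx⟩ := p.succSet_nonempty ht
    exact ⟨t.append x, hx, hst.trans (compat_append t x) (.inl h)⟩

theorem level_nonempty (p : TreeForcing ε n) (k : ℕ) : (p.level k).Nonempty := by
  obtain ⟨s, hs⟩ := p.nonempty
  obtain ⟨t, ht, -⟩ := p.exists_mem_level (Nat.zero_le k) hs
  exact ⟨t, ht⟩

/-- From level `k` on, all nodes of `p` have norm at least `l`. -/
def NormGE (p : TreeForcing ε n) (k l : ℕ) : Prop :=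
  ∀ m, k ≤ m → ∀ s ∈ p.level m, l ≤ blockNorm ε (succSet p.level s)

theorem NormGE.mono {p : TreeForcing ε n} {k k' l l' : ℕ} (h : p.NormGE k l) (hk : k ≤ k')
    (hl : l' ≤ l) : p.NormGE k' l' :=
  fun m hm s hs => hl.trans (h m (hk.trans hm) s hs)

theorem exists_normGE (p : TreeForcing ε n) (l k₀ : ℕ) : ∃ k, k₀ ≤ k ∧ p.NormGE k l := by
  obtain ⟨k, hk⟩ := Filter.eventually_atTop.1 (p.tendsto_norm.eventually_ge_atTop l)
  refine ⟨max k₀ k, le_max_left _ _, fun m hm s hs => ?_⟩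
  exact (hk m ((le_max_right _ _).trans hm)).trans (Nat.sInf_le ⟨s, hs, rfl⟩)

/-- Perfectness need not be checked: large norms force branching. -/
theorem exists_of_levels {g : ℕ → ℕ} (hg : StrictMono g) (hε : IsNormScale ε)
    (hn : IsPartitionFor g ε n) (L : ∀ k, Set (Node n k)) (h₀ : (L 0).Nonempty)
    (hi : ∀ k, ∀ s : Node n (k + 1), s ∈ L (k + 1) → s.take k.le_succ ∈ L k)
    (hs : ∀ k, ∀ s ∈ L k, (succSet L s).Nonempty)
    (hl : ∀ l, ∃ k, ∀ m, k ≤ m → ∀ s ∈ L m, l ≤ blockNorm ε (succSet L s)) :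
    ∃ p : TreeForcing ε n, p.level = L := by
  have hext : ∀ k m, k ≤ m → ∀ s ∈ L k, ∃ t ∈ L m, Compat s t := by
    intro k m h s hsk
    induction m, h using Nat.le_induction with
    | base => exact ⟨s, hsk, .refl s⟩
    | succ m h ih =>
      obtain ⟨t, ht, hst⟩ := ih
      obtain ⟨x, hx⟩ := hs m t ht
      exact ⟨t.append x, hx, hst.trans (compat_append t x) (.inl h)⟩
  refine ⟨⟨L, h₀, hi, ?_, ?_⟩, rfl⟩
  · intro k s hsk
    obtain ⟨K, hK⟩ := hl 1
    obtain ⟨t, ht, hst⟩ := hext k (max k K) (le_max_left _ _) s hsk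
    exact ⟨_, le_max_left _ _, t, ht, fun j => (hst j j.2 (by omega)).symm,
      nontrivial_of_one_le_blockNorm hg hε hn (hK _ (le_max_right _ _) t ht)⟩
  · refine Filter.tendsto_atTop.2 fun l => Filter.eventually_atTop.2 ?_
    obtain ⟨K, hK⟩ := hl l
    refine ⟨K, fun m hm => le_csInf ?_ ?_⟩
    · obtain ⟨s, hs0⟩ := h₀
      obtain ⟨t, ht, -⟩ := hext 0 m (Nat.zero_le m) s hs0
      exact ⟨_, t, ht, rfl⟩
    · rintro _ ⟨s, hs, rfl⟩
      exact hK m hm s hs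

/-- Every node of `p` is compatible with `t`. -/
def Through (p : TreeForcing ε n) {a : ℕ} (t : Node n a) : Prop :=
  ∀ j, ∀ u ∈ p.level j, Compat u t

theorem Through.mem {p : TreeForcing ε n} {a b : ℕ} {t : Node n a} (h : p.Through t)
    {s : Node n b} (hb : b ≤ a) (hs : Compat s t) : s ∈ p.level b := by
  obtain ⟨u, hu⟩ := p.level_nonempty b
  rwa [(hs.trans (h b u hu).symm (.inl hb)).eq]

theorem Through.of_compat {p : TreeForcing ε n} {a b : ℕ} {t : Node n a} (h : p.Through t)
    {s : Node n b} (hb : b ≤ a) (hs : Compat s t) : p.Through s :=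
  fun j u hu => (h j u hu).trans hs.symm (.inr hb)

theorem succSet_mono {L L' : ∀ k, Set (Node n k)} (h : ∀ k, L k ⊆ L' k) {k : ℕ} (s : Node n k) :
    succSet L s ⊆ succSet L' s := fun _ hx => h _ hx

/-- The part of `p` through one of its nodes `s`: the weakest condition above `p` that runs
through `s`. -/
theorem exists_restrict {g : ℕ → ℕ} (hg : StrictMono g) (hε : IsNormScale ε)
    (hn : IsPartitionFor g ε n) (p : TreeForcing ε n) {k : ℕ} {s : Node n k}
    (hs : s ∈ p.level k) :
    ∃ q, p ≤ q ∧ q.Through s ∧ (∀ r, p ≤ r → r.Through s → q ≤ r) ∧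
      ∀ m l, k ≤ m → p.NormGE m l → q.NormGE m l := by
  have hsucc : ∀ m (t : Node n m), k ≤ m → Compat t s →
      succSet (fun j => {u ∈ p.level j | Compat u s}) t = succSet p.level t := by
    intro m t hm ht
    ext x
    refine ⟨fun h => h.1, fun h => ⟨h, ?_⟩⟩
    exact (ht.symm.trans (compat_append t x) (.inl hm)).symm
  obtain ⟨q, hq⟩ : ∃ q : TreeForcing ε n, q.level = fun j => {u ∈ p.level j | Compat u s} := by
    refine exists_of_levels hg hε hn _ ?_ ?_ ?_ ?_
    · exact ⟨s.take (Nat.zero_le k), p.take_mem _ hs, compat_take _ _⟩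
    · intro j u hu
      exact ⟨p.take_mem _ hu.1, (compat_take _ u).trans hu.2 (.inl j.le_succ)⟩
    · intro j u hu
      rcases le_or_gt k j with h | h
      · rw [hsucc j u h hu.2]
        exact p.succSet_nonempty hu.1
      · refine ⟨(s.take h) (Fin.last j), ?_⟩
        have : Compat u (s.take h) := hu.2.trans (compat_take h s).symm (.inl h.le)
        rw [succSet, Set.mem_ofPred_eq, this.append_eq]
        exact ⟨p.take_mem h hs, compat_take h s⟩
    · intro l
      obtain ⟨K, hK, hl⟩ := p.exists_normGE l k
      refine ⟨K, fun m hm t ht => ?_⟩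
      rw [hsucc m t (hK.trans hm) ht.2]
      exact hl m hm t ht.1
  have hmem : ∀ j u, u ∈ q.level j ↔ u ∈ p.level j ∧ Compat u s := by
    intro j u; rw [hq]; rfl
  refine ⟨q, fun j u hu => ((hmem j u).1 hu).1, fun j u hu => ((hmem j u).1 hu).2,
    fun r hr hrs j u hu => (hmem j u).2 ⟨hr j hu, hrs j u hu⟩, ?_⟩
  intro m l hm h m' hm' t ht
  rw [hmem] at ht
  rw [hq, hsucc m' t (hm.trans hm') ht.2]
  exact h m' hm' t ht.1

/-- Conditions `q s`, each running through its own node `s ∈ S` of level `k`, have a union, in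
which the part through `s` is `q s`. -/
theorem exists_glue {g : ℕ → ℕ} (hg : StrictMono g) (hε : IsNormScale ε)
    (hn : IsPartitionFor g ε n) {k : ℕ} {S : Set (Node n k)} (hS : S.Nonempty)
    (q : Node n k → TreeForcing ε n) (hq : ∀ s ∈ S, (q s).Through s) :
    ∃ p : TreeForcing ε n, (∀ j t, t ∈ p.level j ↔ ∃ s ∈ S, t ∈ (q s).level j) ∧
      (∀ m l, (∀ s ∈ S, (q s).NormGE m l) → p.NormGE m l) ∧
      (∀ s ∈ S, ∀ r, p ≤ r → r.Through s → q s ≤ r) := by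
  have hsub : ∀ s ∈ S, ∀ j, (q s).level j ⊆ {t | ∃ s ∈ S, t ∈ (q s).level j} :=
    fun s hs j t ht => ⟨s, hs, ht⟩
  obtain ⟨p, hp⟩ : ∃ p : TreeForcing ε n,
      p.level = fun j => {t | ∃ s ∈ S, t ∈ (q s).level j} := by
    refine exists_of_levels hg hε hn _ ?_ ?_ ?_ ?_
    · obtain ⟨s, hs⟩ := hS
      obtain ⟨t, ht⟩ := (q s).nonempty
      exact ⟨t, s, hs, ht⟩
    · rintro j t ⟨s, hs, ht⟩
      exact ⟨s, hs, (q s).take_mem _ ht⟩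
    · rintro j t ⟨s, hs, ht⟩
      exact ((q s).succSet_nonempty ht).mono (succSet_mono (hsub s hs) t)
    · intro l
      choose K _ hK using fun s => (q s).exists_normGE l 0
      obtain ⟨M, hM⟩ := (Set.toFinite (Set.range K)).bddAbove
      refine ⟨M, ?_⟩
      rintro m hm t ⟨s, hs, ht⟩
      exact (hK s m ((hM ⟨s, rfl⟩).trans hm) t ht).trans
        (blockNorm_mono hε (succSet_mono (hsub s hs) t))
  have hmem : ∀ j t, t ∈ p.level j ↔ ∃ s ∈ S, t ∈ (q s).level j := by
    intro j t; rw [hp]; rfl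
  refine ⟨p, hmem, ?_, ?_⟩
  · intro m l h m' hm' t ht
    obtain ⟨s, hs, hts⟩ := (hmem m' t).1 ht
    rw [hp]
    exact (h s hs m' hm' t hts).trans (blockNorm_mono hε (succSet_mono (hsub s hs) t))
  · intro s hs r hr hrs j u hu
    rcases le_or_gt j k with h | h
    · exact (hq s hs).mem h (hrs j u hu)
    · obtain ⟨s', hs', hu'⟩ := (hmem j u).1 (hr j hu)
      rwa [((hrs j u hu).symm.trans (hq s' hs' j u hu') (.inl h.le)).eq]

end TreeForcing

/-! ### Thinning out and deciding -/

namespace TreeForcing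

variable {g : ℕ → ℕ} {ε : ℕ → ℕ → ℝ} {n : ℕ → ℕ}

/-- If every node with the property `B` keeps `B` at a proportion `2^{-j}` of its immediate
successors, then the nodes with property `B` contain a condition: all norms drop by at most one. -/
theorem exists_thinning (hg : StrictMono g) (hε : IsNormScale ε) (hn : IsPartitionFor g ε n)
    (p : TreeForcing ε n) {k : ℕ} {s : Node n k} (hs : s ∈ p.level k)
    (B : ∀ j, Node n j → Prop) (hBs : B k s)
    (hB : ∀ j, k ≤ j → ∀ u ∈ p.level j, B j u →
      (2⁻¹ : ℝ) ^ j * (succSet p.level u).ncard ≤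
        {x ∈ succSet p.level u | B (j + 1) (u.append x)}.ncard) :
    ∃ q, p ≤ q ∧ q.Through s ∧ ∀ j, k ≤ j → ∀ u ∈ q.level j, B j u := by
  set L : ∀ j, Set (Node n j) := fun j =>
    {u | u ∈ p.level j ∧ Compat u s ∧ ∀ i (h : i ≤ j), k ≤ i → B i (u.take h)} with hL
  have hsub : ∀ j, k ≤ j → ∀ u ∈ L j,
      {x ∈ succSet p.level u | B (j + 1) (u.append x)} ⊆ succSet L u := by
    rintro j hj u ⟨hu, hus, huB⟩ x ⟨hx, hxB⟩
    refine ⟨hx, (compat_append u x).symm.trans hus (.inr hj), fun i hi hki => ?_⟩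
    rcases Nat.lt_or_ge j i with h | h
    · obtain rfl : i = j + 1 := by omega
      exact hxB
    · have : (u.append x).take hi = u.take h :=
        (((compat_take hi _).trans (compat_append u x).symm (.inl hi)).trans
          (compat_take h u).symm (.inl h)).eq
      rw [this]
      exact huB i h hki
  have hprop : ∀ j, k ≤ j → ∀ u ∈ L j,
      (2⁻¹ : ℝ) ^ j * (succSet p.level u).ncard ≤ (succSet L u).ncard := by
    intro j hj u hu
    refine (hB j hj u hu.1 (hu.2.2 j le_rfl hj)).trans ?_
    exact_mod_cast Set.ncard_le_ncard (hsub j hj u hu) (Set.toFinite _)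
  obtain ⟨q, hq⟩ : ∃ q : TreeForcing ε n, q.level = L := by
    refine exists_of_levels hg hε hn L ?_ ?_ ?_ ?_
    · refine ⟨s.take (Nat.zero_le k), p.take_mem _ hs, compat_take _ _, ?_⟩
      intro i h hki
      obtain rfl : i = 0 := by omega
      obtain rfl : k = 0 := by omega
      exact hBs
    · intro j u hu
      refine ⟨p.take_mem _ hu.1, (compat_take _ u).trans hu.2.1 (.inl j.le_succ), ?_⟩
      exact fun i h hki => hu.2.2 i (h.trans j.le_succ) hki
    · intro j u hu
      rcases le_or_gt k j with h | h
      · have h₁ : 0 < (succSet p.level u).ncard :=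
          (Set.ncard_pos (Set.toFinite _)).2 (p.succSet_nonempty hu.1)
        have h₂ : (0 : ℝ) < (succSet L u).ncard :=
          lt_of_lt_of_le (by positivity) (hprop j h u hu)
        exact (Set.ncard_pos (Set.toFinite _)).1 (by exact_mod_cast h₂)
      · refine ⟨(s.take h) (Fin.last j), ?_⟩
        have : Compat u (s.take h) := hu.2.1.trans (compat_take h s).symm (.inl h.le)
        rw [succSet, Set.mem_ofPred_eq, this.append_eq]
        refine ⟨p.take_mem h hs, compat_take h s, fun i hi hki => ?_⟩
        obtain rfl : i = k := by omega
        exact hBs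
    · intro l
      obtain ⟨K, hK, hl⟩ := p.exists_normGE (l + 1) k
      refine ⟨K, fun m hm u hu => ?_⟩
      exact le_blockNorm_of_proportion hε (hl m hm u hu.1) (hprop m (hK.trans hm) u hu)
  refine ⟨q, fun j u hu => ?_, fun j u hu => ?_, fun j hj u hu => ?_⟩
  · rw [hq] at hu
    exact hu.1
  · rw [hq] at hu
    exact hu.2.1
  · rw [hq] at hu
    exact hu.2.2 j le_rfl hj

/-- Passing to any node of level `m` decides `D`: every condition above `p` that runs through a
node of `p` of level `m` satisfies `D`. -/
def DecidedAt (p : TreeForcing ε n) (m : ℕ) (D : TreeForcing ε n → Prop) : Prop :=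
  ∀ t ∈ p.level m, ∀ r, p ≤ r → r.Through t → D r

theorem DecidedAt.mono {p : TreeForcing ε n} {m m' : ℕ} {D : TreeForcing ε n → Prop}
    (h : p.DecidedAt m D) (hm : m ≤ m') : p.DecidedAt m' D :=
  fun t ht r hr hrt => h (t.take hm) (p.take_mem hm ht) r hr (hrt.of_compat hm (compat_take hm t))

theorem DecidedAt.of_le {p q : TreeForcing ε n} {m : ℕ} {D : TreeForcing ε n → Prop}
    (h : p.DecidedAt m D) (hpq : p ≤ q) : q.DecidedAt m D :=
  fun t ht r hr hrt => h t (hpq m ht) r (hpq.trans hr) hrt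

/-- The union of finitely many conditions, each deciding `D` at some level, decides `D` at some
level. -/
theorem exists_glue_decidedAt (hg : StrictMono g) (hε : IsNormScale ε)
    (hn : IsPartitionFor g ε n) {k : ℕ} {S : Set (Node n k)} (hS : S.Nonempty)
    (q : Node n k → TreeForcing ε n) (hq : ∀ s ∈ S, (q s).Through s)
    {D : TreeForcing ε n → Prop} (hD : ∀ s ∈ S, ∃ m, (q s).DecidedAt m D) :
    ∃ p : TreeForcing ε n, (∀ j t, t ∈ p.level j ↔ ∃ s ∈ S, t ∈ (q s).level j) ∧
      (∀ m l, (∀ s ∈ S, (q s).NormGE m l) → p.NormGE m l) ∧ ∃ m, p.DecidedAt m D := by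
  obtain ⟨p, hmem, hnorm, hle⟩ := exists_glue hg hε hn hS q hq
  refine ⟨p, hmem, hnorm, ?_⟩
  choose! M hM using hD
  obtain ⟨N, hN⟩ := (Set.toFinite (Set.range M)).bddAbove
  refine ⟨max k N, fun t ht r hr hrt => ?_⟩
  obtain ⟨s, hs, hts⟩ := (hmem _ t).1 ht
  have hrs : r.Through s := hrt.of_compat (le_max_left _ _) ((hq s hs) _ t hts).symm
  exact (hM s hs).mono ((hN ⟨s, rfl⟩).trans (le_max_right _ _)) t hts r (hle s hs r hr hrs) hrt

/-- Some condition above `p` running through `s` decides `D` at a finite level while keeping all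
norms from `s` on at least `l`. -/
def CanDecide (p : TreeForcing ε n) (l : ℕ) (D : TreeForcing ε n → Prop) {k : ℕ} (s : Node n k) :
    Prop :=
  ∃ q, p ≤ q ∧ q.Through s ∧ q.NormGE k l ∧ ∃ m, q.DecidedAt m D

/-- Glue the conditions that witness this for the successors; at `s` itself the norm drops by at
most one. -/
theorem canDecide_of_successors (hg : StrictMono g) (hε : IsNormScale ε)
    (hn : IsPartitionFor g ε n) {p : TreeForcing ε n} {l k : ℕ} {D : TreeForcing ε n → Prop}
    (hp : p.NormGE k (l + 1)) {s : Node n k} (hs : s ∈ p.level k)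
    (h : (2⁻¹ : ℝ) ^ k * (succSet p.level s).ncard ≤
      {x ∈ succSet p.level s | p.CanDecide l D (s.append x)}.ncard) :
    p.CanDecide l D s := by
  set G := {x ∈ succSet p.level s | p.CanDecide l D (s.append x)} with hG
  have hne : (s.append '' G).Nonempty := by
    have h₁ : 0 < (succSet p.level s).ncard :=
      (Set.ncard_pos (Set.toFinite _)).2 (p.succSet_nonempty hs)
    have h₂ : (0 : ℝ) < G.ncard := lt_of_lt_of_le (by positivity) h
    exact ((Set.ncard_pos (Set.toFinite _)).1 (by exact_mod_cast h₂)).image _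
  have hgood : ∀ t ∈ s.append '' G, p.CanDecide l D t := by
    rintro _ ⟨x, hx, rfl⟩
    exact hx.2
  have : Nonempty (TreeForcing ε n) := ⟨p⟩
  choose! q hpq hthr hnorm hdec using hgood
  obtain ⟨P, hmem, hP, hdecP⟩ := exists_glue_decidedAt hg hε hn hne q hthr hdec
  have hPs : P.Through s := by
    intro j t ht
    obtain ⟨u, hu, htu⟩ := (hmem j t).1 ht
    refine (hthr u hu j t htu).trans ?_ (.inr k.le_succ)
    obtain ⟨x, -, rfl⟩ := hu
    exact (compat_append s x).symm
  refine ⟨P, fun j t ht => ?_, hPs, fun m hm t ht => ?_, hdecP⟩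
  · obtain ⟨u, hu, htu⟩ := (hmem j t).1 ht
    exact hpq u hu j htu
  · rcases hm.eq_or_lt with rfl | hm
    · obtain rfl := (hPs _ t ht).eq
      refine (le_blockNorm_of_proportion hε (hp k le_rfl t hs) h).trans (blockNorm_mono hε ?_)
      intro x hx
      exact (hmem _ _).2 ⟨_, ⟨x, hx, rfl⟩, (hthr _ ⟨x, hx, rfl⟩).mem le_rfl (.refl _)⟩
    · exact hP (k + 1) l hnorm m hm t ht

/-- If `s` could not decide `D`, the nodes that cannot decide `D` would contain a condition. A
condition above it satisfying `D` has norms at least `l` beyond some node, which therefore can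
decide `D`. -/
theorem canDecide (hg : StrictMono g) (hε : IsNormScale ε)
    (hn : IsPartitionFor g ε n) {p : TreeForcing ε n} {l k : ℕ} (hk : 1 ≤ k)
    {D : TreeForcing ε n → Prop} (hmono : Monotone D)
    (hD : ∀ r, p ≤ r → ∃ r', r ≤ r' ∧ D r')
    (hp : p.NormGE k (l + 1)) {s : Node n k} (hs : s ∈ p.level k) : p.CanDecide l D s := by
  by_contra hbad
  obtain ⟨q, hpq, -, hq⟩ := p.exists_thinning hg hε hn hs
    (fun j t => ¬ p.CanDecide l D t) hbad (fun j hj u hu hub => by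
      have h₁ := mt (canDecide_of_successors hg hε hn (hp.mono hj le_rfl) hu) hub
      have h₂ := Set.ncard_inter_add_ncard_sdiff_eq_ncard (succSet p.level u)
        {x | p.CanDecide l D (u.append x)} (Set.toFinite _)
      have h₃ : (2⁻¹ : ℝ) ^ j ≤ 2⁻¹ :=
        pow_le_of_le_one (by norm_num) (by norm_num) (by omega)
      set a := (succSet p.level u).ncard
      have h₄ : (2⁻¹ : ℝ) ^ j * a ≤ 2⁻¹ * a := by gcongr
      rw [not_le] at h₁
      have h₅ : (({x ∈ succSet p.level u | p.CanDecide l D (u.append x)}.ncard : ℕ) : ℝ)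
        + ({x ∈ succSet p.level u | ¬ p.CanDecide l D (u.append x)}.ncard : ℕ) = a := by
          exact_mod_cast h₂
      linarith)
  obtain ⟨r, hqr, hr⟩ := hD q hpq
  obtain ⟨K, hK, hl⟩ := r.exists_normGE l k
  obtain ⟨t, ht⟩ := r.level_nonempty K
  obtain ⟨r', hrr', hthr, -, hnorm⟩ := r.exists_restrict hg hε hn ht
  exact hq K hK t (hqr K ht) ⟨r', (hpq.trans hqr).trans hrr', hthr, hnorm K l le_rfl hl, 0,
    fun _ _ r'' h'' _ => hmono (hrr'.trans h'') hr⟩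

/-- Pure decision: `D` is decided at a finite level without changing `p` up to level `k`. -/
theorem exists_decidedAt (hg : StrictMono g) (hε : IsNormScale ε)
    (hn : IsPartitionFor g ε n) {p : TreeForcing ε n} {l k : ℕ} (hk : 1 ≤ k)
    {D : TreeForcing ε n → Prop} (hmono : Monotone D)
    (hD : ∀ r, p ≤ r → ∃ r', r ≤ r' ∧ D r') (hp : p.NormGE k (l + 1)) :
    ∃ q, p ≤ q ∧ (∀ j ≤ k, q.level j = p.level j) ∧ q.NormGE k l ∧ ∃ m, q.DecidedAt m D := by
  have hgood : ∀ s ∈ p.level k, p.CanDecide l D s :=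
    fun s hs => canDecide hg hε hn hk hmono hD hp hs
  have : Nonempty (TreeForcing ε n) := ⟨p⟩
  choose! q hpq hthr hnorm hdec using hgood
  obtain ⟨P, hmem, hP, hdecP⟩ :=
    exists_glue_decidedAt hg hε hn (p.level_nonempty k) q hthr hdec
  have hpP : p ≤ P := by
    intro j t ht
    obtain ⟨s, hs, hts⟩ := (hmem j t).1 ht
    exact hpq s hs j hts
  refine ⟨P, hpP, fun j hj => (hpP j).antisymm fun t ht => ?_, hP k l hnorm, hdecP⟩
  obtain ⟨s, hs, hts⟩ := p.exists_mem_level hj ht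
  exact (hmem j t).2 ⟨s, hs, (hthr s hs).mem hj hts⟩

/-! ### Fusion -/

/-- Countably many dense, upward closed properties can be decided simultaneously, each at some
finite level. -/
theorem exists_forall_decidedAt (hg : StrictMono g) (hε : IsNormScale ε)
    (hn : IsPartitionFor g ε n) (p : TreeForcing ε n) (D : ℕ → TreeForcing ε n → Prop)
    (hmono : ∀ i, Monotone (D i)) (hD : ∀ i, ∀ r, p ≤ r → ∃ r', r ≤ r' ∧ D i r') :
    ∃ q, p ≤ q ∧ ∀ i, ∃ m, q.DecidedAt m (D i) := by
  -- A stage `i` of the construction is a condition together with a level from which on its norms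
  -- are at least `i + 1`.
  let C : ℕ → TreeForcing ε n × ℕ → Prop :=
    fun i x => p ≤ x.1 ∧ i + 1 ≤ x.2 ∧ x.1.NormGE x.2 (i + 1)
  have hstep : ∀ i x, C i x → ∃ y : TreeForcing ε n × ℕ, C (i + 1) y ∧ x.1 ≤ y.1 ∧ x.2 ≤ y.2 ∧
      (∀ j ≤ x.2, y.1.level j = x.1.level j) ∧ y.1.NormGE x.2 i ∧ y.1.DecidedAt y.2 (D i) := by
    rintro i ⟨P, k⟩ ⟨hP, hk, hnorm⟩
    obtain ⟨Q, hPQ, hlev, hQ, m, hm⟩ := exists_decidedAt hg hε hn (by omega : 1 ≤ k) (hmono i)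
      (fun r hr => hD i r (hP.trans hr)) hnorm
    obtain ⟨K, hK, hl⟩ := Q.exists_normGE (i + 1 + 1) (max m (k + 1))
    exact ⟨(Q, K), ⟨hP.trans hPQ, by dsimp only at *; omega, hl⟩, hPQ, by dsimp only; omega, hlev,
      hQ, hm.mono ((le_max_left _ _).trans hK)⟩
  obtain ⟨k₀, hk₀, hl₀⟩ := p.exists_normGE (0 + 1) 1
  choose f hfC hf using hstep
  let S : ∀ i, {x // C i x} := fun i => Nat.rec ⟨(p, k₀), le_rfl, hk₀, hl₀⟩
    (fun i x => ⟨f i x.1 x.2, hfC i x.1 x.2⟩) i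
  let P : ℕ → TreeForcing ε n := fun i => (S i).1.1
  let m : ℕ → ℕ := fun i => (S i).1.2
  have hS : ∀ i, P i ≤ P (i + 1) ∧ m i ≤ m (i + 1) ∧
      (∀ j ≤ m i, (P (i + 1)).level j = (P i).level j) ∧ (P (i + 1)).NormGE (m i) i ∧
      (P (i + 1)).DecidedAt (m (i + 1)) (D i) := fun i => hf i (S i).1 (S i).2
  have hm : ∀ i, i + 1 ≤ m i := fun i => (S i).2.2.1
  have hPmono : Monotone P := monotone_nat_of_le_succ fun i => (hS i).1
  have hmmono : Monotone m := monotone_nat_of_le_succ fun i => (hS i).2.1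
  have hlev : ∀ i i', i ≤ i' → ∀ j ≤ m i, (P i').level j = (P i).level j := by
    intro i i' h j hj
    induction i', h using Nat.le_induction with
    | base => rfl
    | succ i' h ih => rw [(hS i').2.2.1 j (hj.trans (hmmono h)), ih]
  have hnorm : ∀ i i', i ≤ i' → (P (i' + 1)).NormGE (m i) i := by
    intro i i' h
    induction i', h using Nat.le_induction with
    | base => exact (hS i).2.2.2.1
    | succ i' h ih =>
      intro k hk s hs
      rcases lt_or_ge k (m (i' + 1)) with hlt | hge
      · rw [hlev (i' + 1) (i' + 1 + 1) (Nat.le_succ _) k hlt.le] at hs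
        have : succSet (P (i' + 1 + 1)).level s = succSet (P (i' + 1)).level s := by
          simp only [succSet, hlev (i' + 1) (i' + 1 + 1) (Nat.le_succ _) (k + 1) hlt]
        rw [this]
        exact ih k hk s hs
      · exact (by omega : i ≤ i' + 1).trans ((hS (i' + 1)).2.2.2.1 k hge s hs)
  let L : ∀ j, Set (Node n j) := fun j => (P j).level j
  have hL : ∀ i j, j ≤ i → L j = (P i).level j := fun i j h =>
    (hlev j i h j (by have := hm j; omega)).symm
  have hLs : ∀ i j, j + 1 ≤ i → ∀ s : Node n j, succSet L s = succSet (P i).level s := by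
    intro i j h s
    simp only [succSet, hL i (j + 1) h]
  obtain ⟨q, hq⟩ : ∃ q : TreeForcing ε n, q.level = L := by
    refine exists_of_levels hg hε hn L (P 0).nonempty ?_ ?_ ?_
    · intro j s hs
      rw [hL (j + 1) (j + 1) le_rfl] at hs
      rw [hL (j + 1) j j.le_succ]
      exact (P (j + 1)).init_mem j s hs
    · intro j s hs
      rw [hLs (j + 1) j le_rfl]
      rw [hL (j + 1) j j.le_succ] at hs
      exact (P (j + 1)).succSet_nonempty hs
    · intro l
      refine ⟨m l, fun j hj s hs => ?_⟩
      have hlj := hm l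
      rw [hLs (j + 1) j le_rfl]
      rw [hL (j + 1) j j.le_succ] at hs
      exact hnorm l j (by omega) j hj s hs
  have hPq : ∀ i, P i ≤ q := by
    intro i j t ht
    rw [hq, hL (max i j) j (le_max_right _ _)] at ht
    exact hPmono (le_max_left i j) j ht
  exact ⟨q, hPq 0, fun i => ⟨_, (hS i).2.2.2.2.of_le (hPq (i + 1))⟩⟩

end TreeForcing

/-! ### Measure estimates -/

section Measure

open MeasureTheory

instance : IsProbabilityMeasure cantorMeasure := by
  unfold cantorMeasure; infer_instance

theorem cylinderOf_eq_pi (c : List Bool) :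
    cylinderOf c = Set.pi (Finset.range c.length) fun i => {c.getD i false} := by
  ext x
  simp only [cylinderOf, Set.mem_pi, Set.mem_ofPred_eq, Set.mem_singleton_iff, Finset.coe_range,
    Set.mem_Iio]
  refine ⟨fun h i hi => ?_, fun h i => ?_⟩
  · rw [h ⟨i, hi⟩, List.getD_eq_getElem _ _ hi]
    rfl
  · rw [h i i.2, List.getD_eq_getElem _ _ i.2]
    rfl

theorem measurableSet_cylinderOf (c : List Bool) : MeasurableSet (cylinderOf c) := by
  rw [cylinderOf_eq_pi]
  exact MeasurableSet.pi (Finset.countable_toSet _) fun _ _ => measurableSet_singleton _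

theorem cantorMeasure_cylinderOf (c : List Bool) :
    cantorMeasure (cylinderOf c) = ENNReal.ofReal ((2⁻¹ : ℝ) ^ c.length) := by
  rw [cylinderOf_eq_pi, cantorMeasure, Measure.infinitePi_pi _ fun _ _ => measurableSet_singleton _]
  simp only [PMF.toMeasure_apply_singleton _ _ (measurableSet_singleton _),
    PMF.uniformOfFintype_apply, Finset.prod_const, Finset.card_range, Fintype.card_bool]
  rw [ENNReal.ofReal_pow (by norm_num), ENNReal.ofReal_inv_of_pos (by norm_num)]
  norm_num

theorem cantorMeasure_biUnion_cylinderOf_le {E : Set (List Bool)} {a : ℝ}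
    (h : ∀ s : Finset (List Bool), (s : Set (List Bool)) ⊆ E →
      ∑ c ∈ s, (2⁻¹ : ℝ) ^ c.length ≤ a) :
    cantorMeasure (⋃ c ∈ E, cylinderOf c) ≤ ENNReal.ofReal a := by
  refine (measure_biUnion_le _ E.to_countable _).trans ?_
  rw [ENNReal.tsum_eq_iSup_sum]
  refine iSup_le fun s => ?_
  simp only [cantorMeasure_cylinderOf]
  rw [← ENNReal.ofReal_sum_of_nonneg fun _ _ => by positivity]
  refine ENNReal.ofReal_le_ofReal ?_
  have := h (s.map (Function.Embedding.subtype _)) (by simp)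
  simpa using this

/-- Points lying outside only a small proportion `δ` of the sets `b i` form a small set, by
Markov's inequality. -/
theorem measureReal_few_notMem_le {Ω ι : Type*} [MeasurableSpace Ω] (μ : Measure Ω)
    [IsFiniteMeasure μ] {S : Set ι} (hS : S.Finite) (hne : S.Nonempty) {b : ι → Set Ω}
    (hb : ∀ i ∈ S, MeasurableSet (b i)) {a δ : ℝ} (hδ : δ < 1)
    (ha : ∀ i ∈ S, μ.real (b i) ≤ a) :
    MeasurableSet {x | ({i ∈ S | x ∉ b i}.ncard : ℝ) < δ * S.ncard} ∧
      μ.real {x | ({i ∈ S | x ∉ b i}.ncard : ℝ) < δ * S.ncard} ≤ a / (1 - δ) := by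
  classical
  lift S to Finset ι using hS
  set f : Ω → ℝ := fun x => ∑ i ∈ S, (b i).indicator (fun _ => (1 : ℝ)) x with hf
  have hfm : Measurable f :=
    Finset.measurable_sum _ fun i hi => measurable_const.indicator (hb i hi)
  have hcount : ∀ x, ({i ∈ (S : Set ι) | x ∉ b i}.ncard : ℝ) = S.card - f x := by
    intro x
    have h₁ : {i ∈ (S : Set ι) | x ∉ b i} = ((S.filter fun i => x ∉ b i : Finset ι) : Set ι) := by
      ext; simp
    have h₂ : f x = (S.filter fun i => x ∈ b i).card := by
      simp [hf, Set.indicator_apply]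
    have h₃ := Finset.card_filter_add_card_filter_not (s := S) (fun i => x ∈ b i)
    rw [h₁, Set.ncard_coe_finset, h₂, ← h₃]
    push_cast
    ring
  have hset : {x | ({i ∈ (S : Set ι) | x ∉ b i}.ncard : ℝ) < δ * (S : Set ι).ncard} =
      {x | (1 - δ) * S.card < f x} := by
    ext x
    rw [Set.mem_ofPred_eq, Set.mem_ofPred_eq, hcount, Set.ncard_coe_finset]
    constructor <;> intro h <;> linarith
  rw [hset]
  refine ⟨measurableSet_lt measurable_const hfm, ?_⟩
  have hint : ∀ i ∈ S, Integrable ((b i).indicator fun _ => (1 : ℝ)) μ :=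
    fun i hi => (integrable_const 1).indicator (hb i hi)
  have h₁ : ∫ x, f x ∂μ = ∑ i ∈ S, μ.real (b i) := by
    rw [hf, integral_finsetSum _ hint]
    exact Finset.sum_congr rfl fun i hi => by
      rw [integral_indicator_const _ (hb i hi), smul_eq_mul, mul_one]
  have h₂ := mul_meas_ge_le_integral_of_nonneg (μ := μ) (f := f)
    (.of_forall fun x => Finset.sum_nonneg fun i _ =>
      Set.indicator_nonneg (fun _ _ => zero_le_one) _)
    (integrable_finsetSum _ hint) ((1 - δ) * S.card)
  have h₃ : ∑ i ∈ S, μ.real (b i) ≤ S.card * a := by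
    rw [← nsmul_eq_mul]
    exact Finset.sum_le_card_nsmul _ _ _ ha
  have h₄ : μ.real {x | (1 - δ) * S.card < f x} ≤ μ.real {x | (1 - δ) * S.card ≤ f x} :=
    measureReal_mono (by
      intro x hx
      rw [Set.mem_ofPred_eq] at hx ⊢
      exact hx.le)
  have hcard : (0 : ℝ) < S.card := by
    exact_mod_cast Finset.card_pos.2 (by simpa using hne)
  rw [le_div_iff₀ (by linarith)]
  have h₅ : S.card * (μ.real {x | (1 - δ) * S.card < f x} * (1 - δ)) ≤ S.card * a := by
    calc S.card * (μ.real {x | (1 - δ) * S.card < f x} * (1 - δ))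
        = ((1 - δ) * S.card) * μ.real {x | (1 - δ) * S.card < f x} := by ring
      _ ≤ ((1 - δ) * S.card) * μ.real {x | (1 - δ) * S.card ≤ f x} := by
        have : (0 : ℝ) < 1 - δ := by linarith
        gcongr
      _ ≤ S.card * a := h₂.trans (h₁.le.trans h₃)
  exact le_of_mul_le_mul_left h₅ hcard

end Measure

/-! ### Points lost at a node -/

namespace TreeForcing

open MeasureTheory

variable {g : ℕ → ℕ} {ε : ℕ → ℕ → ℝ} {n : ℕ → ℕ}

/-- The strings that the node `t` of `p` puts into the cover. -/
def coverAt (p : TreeForcing ε n) (F : TreeForcing ε n → Set (List Bool)) {k : ℕ}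
    (t : Node n k) : Set (List Bool) :=
  {c | ∀ r, p ≤ r → r.Through t → c ∈ F r}

/-- The points lost at the node `t` when looking `d` levels ahead: for `d = 0` those covered at
`t`, for `d + 1` those for which a proportion of less than `2^{-k}` of the successors of `t` is not
lost when looking `d` levels ahead. -/
def lostSet (p : TreeForcing ε n) (F : TreeForcing ε n → Set (List Bool)) :
    ℕ → ∀ k, Node n k → Set (ℕ → Bool)
  | 0, _, t => ⋃ c ∈ p.coverAt F t, cylinderOf c
  | d + 1, k, t => {x | ({y ∈ succSet p.level t | x ∉ lostSet p F d (k + 1) (t.append y)}.ncard : ℝ)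
      < (2⁻¹ : ℝ) ^ k * (succSet p.level t).ncard}

theorem lostSet_mono (p : TreeForcing ε n) (F : TreeForcing ε n → Set (List Bool)) {k : ℕ}
    {t : Node n k} (ht : t ∈ p.level k) : Monotone fun d => p.lostSet F d k t := by
  refine monotone_nat_of_le_succ fun d => ?_
  induction d generalizing k with
  | zero =>
    intro x hx
    simp only [lostSet, Set.mem_iUnion] at hx
    obtain ⟨c, hc, hxc⟩ := hx
    have h₁ : {y ∈ succSet p.level t | x ∉ p.lostSet F 0 (k + 1) (t.append y)} = ∅ := by
      refine Set.eq_empty_of_forall_notMem fun y hy => hy.2 ?_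
      simp only [lostSet, Set.mem_iUnion]
      exact ⟨c, fun r hr hrt => hc r hr (hrt.of_compat k.le_succ (compat_append t y)), hxc⟩
    have h₂ : 0 < (succSet p.level t).ncard :=
      (Set.ncard_pos (Set.toFinite _)).2 (p.succSet_nonempty ht)
    change (_ : ℝ) < _
    rw [h₁, Set.ncard_empty, Nat.cast_zero]
    exact mul_pos (by positivity) (Nat.cast_pos.2 h₂)
  | succ d ih =>
    intro x hx
    refine lt_of_le_of_lt ?_ (show (_ : ℝ) < _ from hx)
    refine Nat.cast_le.2 (Set.ncard_le_ncard ?_ (Set.toFinite _))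
    exact fun y hy => ⟨hy.1, fun h => hy.2 (ih hy.1 h)⟩

/-- Each level costs a factor `1 / (1 - 2^{-k})`; the bounds `a / (1 - 2 · 2^{-k})` absorb it, since
`1 - 2 z ≤ (1 - z) ^ 2`. -/
theorem measurableSet_lostSet_and_le (p : TreeForcing ε n) (F : TreeForcing ε n → Set (List Bool))
    {a : ℝ} (ha : 0 ≤ a)
    (hF : ∀ k, ∀ t ∈ p.level k,
      cantorMeasure (⋃ c ∈ p.coverAt F t, cylinderOf c) ≤ ENNReal.ofReal a)
    (d : ℕ) {k : ℕ} (hk : 2 ≤ k) {t : Node n k} (ht : t ∈ p.level k) :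
    MeasurableSet (p.lostSet F d k t) ∧
      cantorMeasure.real (p.lostSet F d k t) ≤ a / (1 - 2 * (2⁻¹ : ℝ) ^ k) := by
  induction d generalizing k with
  | zero =>
    refine ⟨MeasurableSet.biUnion (Set.to_countable _) fun c _ => measurableSet_cylinderOf c, ?_⟩
    have h₁ : (2⁻¹ : ℝ) ^ k ≤ 2⁻¹ ^ 2 := pow_le_pow_of_le_one (by norm_num) (by norm_num) hk
    have h₂ : (0 : ℝ) < (2⁻¹ : ℝ) ^ k := by positivity
    refine (ENNReal.toReal_le_of_le_ofReal ha (hF k t ht)).trans ?_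
    rw [le_div_iff₀ (by norm_num at h₁ ⊢; linarith)]
    nlinarith
  | succ d ih =>
    have h₁ : (2⁻¹ : ℝ) ^ k ≤ 2⁻¹ ^ 2 := pow_le_pow_of_le_one (by norm_num) (by norm_num) hk
    set z := (2⁻¹ : ℝ) ^ k with hz
    have hz₀ : 0 < z := by positivity
    have hz₁ : z ≤ 1 / 4 := by norm_num at h₁ ⊢; linarith
    obtain ⟨hm, hle⟩ := measureReal_few_notMem_le cantorMeasure
      (S := succSet p.level t) (b := fun y => p.lostSet F d (k + 1) (t.append y))
      (Set.toFinite _) (p.succSet_nonempty ht) (δ := z)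
      (a := a / (1 - 2 * (2⁻¹ : ℝ) ^ (k + 1))) (fun y hy => (ih (by omega) hy).1) (by linarith)
      (fun y hy => (ih (by omega) hy).2)
    refine ⟨hm, hle.trans ?_⟩
    have h₂ : 1 - 2 * (2⁻¹ : ℝ) ^ (k + 1) = 1 - z := by rw [pow_succ, ← hz]; ring
    rw [h₂, div_div]
    exact div_le_div_of_nonneg_left ha (by linarith) (by nlinarith)

theorem cantorMeasure_iUnion_lostSet_le (p : TreeForcing ε n)
    (F : TreeForcing ε n → Set (List Bool)) {a : ℝ} (ha : 0 ≤ a)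
    (hF : ∀ k, ∀ t ∈ p.level k,
      cantorMeasure (⋃ c ∈ p.coverAt F t, cylinderOf c) ≤ ENNReal.ofReal a)
    {t : Node n 2} (ht : t ∈ p.level 2) :
    cantorMeasure (⋃ d, p.lostSet F d 2 t) ≤ ENNReal.ofReal (2 * a) := by
  rw [(p.lostSet_mono F ht).measure_iUnion]
  refine iSup_le fun d => ?_
  have := (p.measurableSet_lostSet_and_le F ha hF d le_rfl ht).2
  rw [← ofReal_measureReal]
  refine ENNReal.ofReal_le_ofReal (this.trans (le_of_eq ?_))
  norm_num
  ring

/-- A point not lost at `s` is, on a condition through `s`, not lost at any node from `s` on. -/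
theorem exists_forall_notMem_lostSet (hg : StrictMono g) (hε : IsNormScale ε)
    (hn : IsPartitionFor g ε n) (p : TreeForcing ε n) (F : TreeForcing ε n → Set (List Bool))
    {k : ℕ} {s : Node n k} (hs : s ∈ p.level k) {x : ℕ → Bool}
    (hx : ∀ d, x ∉ p.lostSet F d k s) :
    ∃ q, p ≤ q ∧ q.Through s ∧ ∀ j, k ≤ j → ∀ u ∈ q.level j, ∀ d, x ∉ p.lostSet F d j u := by
  refine p.exists_thinning hg hε hn hs (fun j u => ∀ d, x ∉ p.lostSet F d j u) hx ?_
  intro j hj u hu hxu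
  -- Finitely many successors, so a single `d` witnesses all that are lost.
  have hd : ∃ d, ∀ y ∈ succSet p.level u, x ∉ p.lostSet F d (j + 1) (u.append y) →
      ∀ d', x ∉ p.lostSet F d' (j + 1) (u.append y) := by
    have : ∀ y, ∃ d, x ∉ p.lostSet F d (j + 1) (u.append y) →
        ∀ d', x ∉ p.lostSet F d' (j + 1) (u.append y) := by
      intro y
      by_contra! h
      obtain ⟨h₁, d, h₂⟩ := h 0
      exact (h d).1 h₂
    choose f hf using this
    obtain ⟨d, hd⟩ := (Set.toFinite (Set.range f)).bddAbove
    exact ⟨d, fun y hy h => hf y fun h' => h (p.lostSet_mono F hy (hd ⟨y, rfl⟩) h')⟩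
  obtain ⟨d, hd⟩ := hd
  have h₁ := hxu (d + 1)
  simp only [lostSet, Set.mem_ofPred_eq, not_lt] at h₁
  refine h₁.trans (Nat.cast_le.2 (Set.ncard_le_ncard ?_ (Set.toFinite _)))
  exact fun y hy => ⟨hy.1, hd y hy.1 hy.2⟩

end TreeForcing

/-! ### Preservation of non-null sets -/

theorem mainTheorem6 (g : ℕ → ℕ) (hg : StrictMono g)
    (ε : ℕ → ℕ → ℝ) (hε : IsNormScale ε)
    (n : ℕ → ℕ) (hn : IsPartitionFor g ε n)
    (X : Set (ℕ → Bool)) (hX : cantorMeasure X ≠ 0) :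
    ForcingStatement.HoldsInExtension
      (ForcingStatement.not
        (isNullStatement (checkName (TreeForcing ε n) (realsSet X)))) := by
  intro _ p₀ _ hnull
  obtain ⟨K, hK⟩ := ENNReal.exists_inv_two_pow_lt hX
  obtain ⟨p, -, F, hFmono, hFsum, hFcov⟩ := exists_cover_of_isNullStatement hnull (K + 1)
  obtain ⟨e, he⟩ := exists_surjective_nat (List Bool)
  obtain ⟨q, hpq, hdec⟩ := p.exists_forall_decidedAt hg hε hn
    (fun i r => e i ∈ F r ∨ ∀ r', r ≤ r' → e i ∉ F r')
    (by
      rintro i r r' hr (h | h)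
      · exact .inl (hFmono hr h)
      · exact .inr fun r'' h' => h r'' (hr.trans h'))
    (by
      intro i r _
      by_cases h : ∃ r', r ≤ r' ∧ e i ∈ F r'
      · obtain ⟨r', hr, h⟩ := h
        exact ⟨r', hr, .inl h⟩
      · push Not at h
        exact ⟨r, le_rfl, .inr h⟩)
  have hcover : ∀ k, ∀ t ∈ q.level k, cantorMeasure (⋃ c ∈ q.coverAt F t, cylinderOf c) ≤
      ENNReal.ofReal ((2⁻¹ : ℝ) ^ (K + 1)) := by
    intro k t ht
    obtain ⟨r, hqr, hrt, -⟩ := q.exists_restrict hg hε hn ht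
    exact cantorMeasure_biUnion_cylinderOf_le fun E hE =>
      hFsum r (hpq.trans hqr) E fun c hc => hE hc r hqr hrt
  obtain ⟨s, hs⟩ := q.level_nonempty 2
  have hlost := q.cantorMeasure_iUnion_lostSet_le F (by positivity) hcover hs
  obtain ⟨x, hxX, hx⟩ : ∃ x ∈ X, x ∉ ⋃ d, q.lostSet F d 2 s := by
    by_contra! h
    refine (((MeasureTheory.measure_mono h).trans hlost).trans_lt ?_).false
    refine lt_of_eq_of_lt ?_ hK
    rw [pow_succ', mul_inv_cancel_left₀ two_ne_zero, ENNReal.ofReal_pow (by norm_num),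
      ENNReal.ofReal_inv_of_pos (by norm_num)]
    norm_num
  simp only [Set.mem_iUnion, not_exists] at hx
  obtain ⟨q', hqq', -, hq'⟩ := q.exists_forall_notMem_lostSet hg hε hn F hs hx
  obtain ⟨r, hq'r, c, hcr, hxc⟩ := hFcov x hxX q' (hpq.trans hqq')
  obtain ⟨i, rfl⟩ := he c
  obtain ⟨m, hm⟩ := hdec i
  obtain ⟨t, ht⟩ := r.level_nonempty (max 2 m)
  have htq' := hq'r _ ht
  obtain ⟨u, hqu, hut, hu, -⟩ := q.exists_restrict hg hε hn (hqq' _ htq')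
  obtain ⟨v, hrv, hvt, -⟩ := r.exists_restrict hg hε hn ht
  have huv : u ≤ v := hu v ((hqq'.trans hq'r).trans hrv) hvt
  -- The part of `q` through `t` cannot force `e i` out of the cover because of `v`.
  have hcu : e i ∈ F u := (hm.mono (le_max_right 2 m) t (hqq' _ htq') u hqu hut).resolve_right
    fun h => h v huv (hFmono hrv hcr)
  refine hq' _ (le_max_left 2 m) t htq' 0 (Set.mem_biUnion ?_ hxc)
  exact fun w hw hwt => hFmono (hu w hw hwt) hcu
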